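/- Let $d\ge 1$ and put $p_i=1+y_i$ for $1\le i\le d$ and $q_j=1+y_j+y_jy_{j+1}$ for $1\le j\le d-1$ in $\mathbb C[y_1,\dots,y_d]$. Let $\mathcal U_d\subset(\mathbb C^*)^d$ (the open Pellspace) be the complement of the vanishing loci of the $p_i$ and $q_j$. Let $\Lambda$ be the group of Laurent monomials $z^{\alpha}=y^ap^bq^c=\prod_{i=1}^d y_i^{a_i}\prod_{i=1}^d p_i^{b_i}\prod_{j=1}^{d-1}q_j^{c_j}$, $\alpha=(a,b,c)\in\mathbb Z^d\times\mathbb Z^d\times\mathbb Z^{d-1}$, viewed as invertible regular functions on $\mathcal U_d$, and let $\Gamma\subset\Lambda$ be the semigroup (with identity) of those elements that are bounded on $\mathbb R_{>0}^d$. For a nonzero polynomial $F$ with non-negative coefficients and $Y\in\mathbb Z^d$ let $\operatorname{trop}(F)(Y)$ be the minimum of $\sum_i m_iY_i$ over the monomials $y^m$ occurring in $F$. Let $M_d$ be the $(3d-1)\times(3d-1)$ matrix with entries $\operatorname{trop}(F_i)(V_j)$, where $$(F_1,\dots,F_{3d-1})=(y_1,\dots,y_d,p_1,\dots,p_d,q_1,\dots,q_{d-1}),$$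 $$(V_1,\dots,V_{3d-1})=(e_1,\dots,e_d,-e_1,\dots,-e_d,e_1-e_2,\dots,e_{d-1}-e_d).$$ Then the following hold. 1. $M_d$ is invertible over $\mathbb Z$. If $\beta_i=(a_i,b_i,c_i)$, $1\le i\le 3d-1$, denote the rows of $M_d^{-1}$ and $u_i=z^{\beta_i}=y^{a_i}p^{b_i}q^{c_i}$, then $$u_i=\frac{y_ip_{i+1}}{q_i},\quad u_d=\frac{y_d}{p_d},\quad u_{d+1}=\frac1{p_1},\quad u_{d+1+i}=\frac{p_i}{q_i},\quad u_{2d+i}=\frac{q_i}{p_ip_{i+1}}\qquad(1\le i\le d-1).$$ 2. The $u_1,\dots,u_{3d-1}$ are the minimal generators of $\Gamma$: they are exactly the elements of $\Gamma\setminus\{1\}$ that are not a product of two elements of $\Gamma\setminus\{1\}$, they generate $\Gamma$, and every generating set of $\Gamma$ contains all of them. 3. $\Lambda$ is the character lattice of $\mathcal U_d$, that is, every invertible regular function on $\mathcal U_d$ can be written uniquely as a nonzero constant times an element of $\Lambda$; and $u_1,\dots,u_{3d-1}$ form a $\mathbb Z$-basis of $\Lambda$. -/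

import Mathlib

open MvPolynomial

/-- The polynomial ring `ℂ[y_1, …, y_d]`, where `d = n + 1` with `n : ℕ` (so `d` ranges over all
integers `≥ 1`). The variables are numbered from `0` to `n`. -/
abbrev PellPoly (n : ℕ) : Type := MvPolynomial (Fin (n + 1)) ℂ

/-- The index set with `3d - 1` elements: `d` elements `inl i` (for `y_i`, or the ray through
`e_i`), `d` elements `inr (inl i)` (for `p_i`, or the ray through `-e_i`), and `d - 1` elements
`inr (inr j)` (for `q_j`, or the ray through `e_j - e_{j+1}`). -/
abbrev PellIndex (n : ℕ) : Type := Fin (n + 1) ⊕ Fin (n + 1) ⊕ Fin n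

noncomputable section

/-- `p_i = 1 + y_i`. -/
def pellP (n : ℕ) (i : Fin (n + 1)) : PellPoly n := 1 + X i

/-- `q_j = 1 + y_j + y_j y_{j+1}`. -/
def pellQ (n : ℕ) (j : Fin n) : PellPoly n :=
  1 + X j.castSucc + X j.castSucc * X j.succ

/-- The tuple `F = (y_1, …, y_d, p_1, …, p_d, q_1, …, q_{d-1})`. -/
def pellF (n : ℕ) : PellIndex n → PellPoly n
  | .inl i => X i
  | .inr (.inl i) => pellP n i
  | .inr (.inr j) => pellQ n j

/-- The tuple `V = (e_1, …, e_d, -e_1, …, -e_d, e_1 - e_2, …, e_{d-1} - e_d)`. -/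
def pellRay (n : ℕ) : PellIndex n → Fin (n + 1) → ℤ
  | .inl i => Pi.single i 1
  | .inr (.inl i) => -Pi.single i 1
  | .inr (.inr j) => Pi.single j.castSucc 1 - Pi.single j.succ 1

/-- The tropicalization (min-plus convention) of a nonzero polynomial with positive coefficients,
evaluated at a lattice point `Y`: the minimum over the monomials `y^m` occurring in `F` of
`∑ i, m_i Y_i`. -/
def tropPoly {n : ℕ} (F : PellPoly n) (Y : Fin (n + 1) → ℤ) : ℤ :=
  ⨅ m : F.support, ∑ i, (m.1 i : ℤ) * Y i

/-- The matrix `M_d`, with entries `m_{ij} = trop(F_i)(V_j)`. -/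
def pellMatrix (n : ℕ) : Matrix (PellIndex n) (PellIndex n) ℤ :=
  Matrix.of fun i j => tropPoly (pellF n i) (pellRay n j)

/-- The open Pellspace: the points of the torus `(ℂ^*)^d` at which no `p_i` and no `q_j`
vanishes. -/
def openPellspace (n : ℕ) : Set (Fin (n + 1) → ℂ) :=
  {x | (∀ i, x i ≠ 0) ∧ (∀ i, eval x (pellP n i) ≠ 0) ∧ ∀ j, eval x (pellQ n j) ≠ 0}

/-- The product of all `y_i`, `p_i` and `q_j`; the open Pellspace is its non-vanishing locus in
`ℂ^d` (see `mem_openPellspace_iff`). -/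
def pellProd (n : ℕ) : PellPoly n := ∏ k, pellF n k

theorem mem_openPellspace_iff (n : ℕ) (x : Fin (n + 1) → ℂ) :
    x ∈ openPellspace n ↔ eval x (pellProd n) ≠ 0 := by
  simp [openPellspace, pellProd, pellF, Fintype.prod_sum_type, Finset.prod_ne_zero_iff,
    map_prod]

/-- The coordinate ring `ℂ[𝒰_d] = ℂ[y_1, …, y_d][y_i⁻¹, p_i⁻¹, q_j⁻¹]` of the open Pellspace. -/
abbrev PellRing (n : ℕ) : Type := Localization.Away (pellProd n)

/-- The value of a regular function at a point of the open Pellspace. -/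
def pellEval {n : ℕ} (x : openPellspace n) : PellRing n →+* ℂ :=
  IsLocalization.Away.lift (S := PellRing n) (g := eval (x : Fin (n + 1) → ℂ)) (pellProd n)
    (((mem_openPellspace_iff n x).1 x.2).isUnit)

theorem isUnit_pellF (n : ℕ) (k : PellIndex n) :
    IsUnit (algebraMap (PellPoly n) (PellRing n) (pellF n k)) :=
  isUnit_of_dvd_unit (map_dvd _ (Finset.dvd_prod_of_mem (pellF n) (Finset.mem_univ k)))
    (IsLocalization.Away.algebraMap_isUnit (pellProd n))

/-- The `F_k` (that is, `y_i`, `p_i` and `q_j`) as invertible regular functions on the open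
Pellspace. -/
def pellUnit (n : ℕ) (k : PellIndex n) : (PellRing n)ˣ := (isUnit_pellF n k).unit

/-- `y_i` as an invertible regular function. -/
def yUnit (n : ℕ) (i : Fin (n + 1)) : (PellRing n)ˣ := pellUnit n (.inl i)

/-- `p_i` as an invertible regular function. -/
def pUnit (n : ℕ) (i : Fin (n + 1)) : (PellRing n)ˣ := pellUnit n (.inr (.inl i))

/-- `q_j` as an invertible regular function. -/
def qUnit (n : ℕ) (j : Fin n) : (PellRing n)ˣ := pellUnit n (.inr (.inr j))

/-- The Laurent monomial `z^α = y^a p^b q^c` for `α = (a, b, c)`. -/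
def laurentMonomial (n : ℕ) (α : PellIndex n → ℤ) : (PellRing n)ˣ :=
  ∏ k, pellUnit n k ^ α k

/-- The nonzero constant functions. -/
def constUnit (n : ℕ) : ℂˣ →* (PellRing n)ˣ :=
  Units.map (algebraMap ℂ (PellRing n)).toMonoidHom

/-- The lattice `Λ` of Laurent monomials in the `y_i`, `p_i`, `q_j`. -/
def charLattice (n : ℕ) : Subgroup (PellRing n)ˣ where
  carrier := Set.range (laurentMonomial n)
  one_mem' := ⟨0, by simp [laurentMonomial]⟩
  mul_mem' := by
    rintro _ _ ⟨α, rfl⟩ ⟨β, rfl⟩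
    exact ⟨α + β, by simp [laurentMonomial, zpow_add, Finset.prod_mul_distrib]⟩
  inv_mem' := by
    rintro _ ⟨α, rfl⟩
    exact ⟨-α, by simp [laurentMonomial]⟩

theorem ofReal_mem_openPellspace {n : ℕ} (y : Fin (n + 1) → ℝ) (hy : ∀ i, 0 < y i) :
    (fun i => (y i : ℂ)) ∈ openPellspace n := by
  refine ⟨fun i => by simpa using (hy i).ne', fun i => ?_, fun j => ?_⟩
  · have h : (1 + y i : ℝ) ≠ 0 := by linarith [hy i] |> fun h : 0 < 1 + y i => h.ne'
    simp only [pellP, map_add, map_one, eval_X]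
    exact_mod_cast h
  · have h : (1 + y j.castSucc + y j.castSucc * y j.succ : ℝ) ≠ 0 := by
      have := hy j.castSucc
      have := hy j.succ
      positivity
    simp only [pellQ, map_add, map_mul, map_one, eval_X]
    exact_mod_cast h

/-- A regular function is bounded if it takes bounded values on the positive orthant
`ℝ_{>0}^d`. -/
def IsBoundedOnPositive {n : ℕ} (f : PellRing n) : Prop :=
  ∃ C : ℝ, ∀ (y : Fin (n + 1) → ℝ) (hy : ∀ i, 0 < y i),
    ‖pellEval ⟨fun i => (y i : ℂ), ofReal_mem_openPellspace y hy⟩ f‖ ≤ C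

/-- The semigroup (with identity) `Γ ⊆ Λ` of bounded characters. -/
def boundedChars (n : ℕ) : Submonoid (PellRing n)ˣ where
  carrier := {f | f ∈ charLattice n ∧ IsBoundedOnPositive (f : PellRing n)}
  one_mem' := ⟨one_mem _, 1, fun y hy => by simp⟩
  mul_mem' := by
    rintro f g ⟨hf, C, hC⟩ ⟨hg, D, hD⟩
    refine ⟨mul_mem hf hg, C * D, fun y hy => ?_⟩
    rw [Units.val_mul, map_mul, norm_mul]
    exact mul_le_mul (hC y hy) (hD y hy) (norm_nonneg _) ((norm_nonneg _).trans (hC y hy))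

/-- The elements of `Γ` other than `1` that are not a product of two elements of `Γ` other
than `1`. -/
def indecomposables {G : Type*} [CommGroup G] (Γ : Submonoid G) : Set G :=
  {u | u ∈ Γ ∧ u ≠ 1 ∧ ∀ w₁ ∈ Γ, ∀ w₂ ∈ Γ, u = w₁ * w₂ → w₁ = 1 ∨ w₂ = 1}

/-- The characters `u_i = z^{β_i}`, where `β_i` is the `i`-th row of `M_d⁻¹`. -/
def pellU (n : ℕ) (i : PellIndex n) : (PellRing n)ˣ :=
  laurentMonomial n ((pellMatrix n)⁻¹ i)

end

/-!
A polynomial `F` with nonnegative coefficients grows like `s ^ trop(F)(V)` along the curve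
`y = s ^ V` as `s → 0⁺`, because its terms cannot cancel. Hence a Laurent monomial `z^α` grows like
`s ^ (α M)_j` along the curve of the ray `V_j`, and if it is bounded then `α M` has nonnegative
entries. These entries are the exponents of `z^α` with respect to the `u_k`, and `0 < u_k ≤ 1` on
the positive orthant, so the bounded characters are exactly the products of the `u_k`. The same
growth estimate, applied to `z^α` and its inverse, shows that a constant `z^α` has `α = 0`; thus the
`u_k` are independent, and in a free commutative monoid the basis consists of the indecomposables.
Finally, `ℂ[𝒰_d]` is the localization of a factorial ring at the primes `y_i`, `p_i`, `q_j`, so its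
units are the products of these primes, their inverses and units of `ℂ[y]`, that is, constants.
-/

section FreeSubmonoid

variable {G ι : Type*} [CommGroup G]

theorem indecomposables_subset_of_closure_eq {Γ : Submonoid G} {S : Set G}
    (hS : Submonoid.closure S = Γ) : indecomposables Γ ⊆ S := by
  subst hS
  rintro w ⟨hw, hw_ne, hw_dec⟩
  induction hw using Submonoid.closure_induction with
  | mem x hx => exact hx
  | one => exact absurd rfl hw_ne
  | mul x y hx hy ihx ihy =>
    rcases hw_dec x hx y hy rfl with rfl | rfl
    · simp only [one_mul] at hw_ne hw_dec ⊢
      exact ihy hw_ne hw_dec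
    · simp only [mul_one] at hw_ne hw_dec ⊢
      exact ihx hw_ne hw_dec

variable {u : ι → G}

theorem range_subset_indecomposables_closure
    (hu : LinearIndependent ℕ fun i => Additive.ofMul (u i)) :
    Set.range u ⊆ indecomposables (Submonoid.closure (Set.range u)) := by
  rintro _ ⟨i, rfl⟩
  refine ⟨Submonoid.subset_closure ⟨i, rfl⟩, hu.ne_zero i, fun w₁ h₁ w₂ h₂ h => ?_⟩
  obtain ⟨a, rfl⟩ := Submonoid.mem_closure_range_iff.1 h₁
  obtain ⟨b, rfl⟩ := Submonoid.mem_closure_range_iff.1 h₂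
  have hab : a + b = Finsupp.single i 1 := by
    apply hu
    rw [map_add, Finsupp.linearCombination_single, one_smul]
    exact h.symm
  have hdeg : a.degree + b.degree = 1 := by
    rw [← map_add, hab, Finsupp.degree_single]
  rcases Nat.add_eq_one_iff.1 hdeg with ⟨ha, -⟩ | ⟨-, hb⟩
  · left
    rw [(Finsupp.degree_eq_zero_iff a).1 ha, Finsupp.prod_zero_index]
  · right
    rw [(Finsupp.degree_eq_zero_iff b).1 hb, Finsupp.prod_zero_index]

theorem range_eq_indecomposables_closure
    (hu : LinearIndependent ℕ fun i => Additive.ofMul (u i)) :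
    Set.range u = indecomposables (Submonoid.closure (Set.range u)) :=
  (range_subset_indecomposables_closure hu).antisymm (indecomposables_subset_of_closure_eq rfl)

theorem isLeast_range_closure_eq (hu : LinearIndependent ℕ fun i => Additive.ofMul (u i)) :
    IsLeast {S : Set G | Submonoid.closure S = Submonoid.closure (Set.range u)} (Set.range u) :=
  ⟨rfl, fun _ hS =>
    (range_subset_indecomposables_closure hu).trans (indecomposables_subset_of_closure_eq hS)⟩

end FreeSubmonoid

section LocalizationUnits

theorem range_unitsMap_sup_closure_eq_top {R S ι : Type*} [CommRing R] [IsDomain R] [CommRing S]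
    [Algebra R S] [Fintype ι] {F : ι → R} [IsLocalization.Away (∏ k, F k) S]
    (hF : ∀ k, Prime (F k)) {v : ι → Sˣ} (hv : ∀ k, (v k : S) = algebraMap R S (F k)) :
    (Units.map (algebraMap R S : R →* S)).range ⊔ Subgroup.closure (Set.range v) = ⊤ := by
  classical
  set H := (Units.map (algebraMap R S : R →* S)).range ⊔ Subgroup.closure (Set.range v)
  have hvH (k : ι) : v k ∈ H :=
    SetLike.le_def.1 le_sup_right (Subgroup.subset_closure ⟨k, rfl⟩)
  have h_algebraMap (g : Sˣ) (a : R) (ha : (g : S) = algebraMap R S a) : g ∈ H := by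
    obtain ⟨m, b, hb⟩ := (IsLocalization.Away.algebraMap_isUnit_iff (S := S) (∏ k, F k)).1
      (ha ▸ g.isUnit)
    have hab : a * b = 1 * ∏ x : ι × Fin m, F x.1 := by
      simp [← hb, Fintype.prod_prod_type_right]
    obtain ⟨t, -, c, c', -, -, hc, rfl, -⟩ := mul_eq_mul_prime_prod (fun x _ => hF x.1) hab
    have hg : g = Units.map (algebraMap R S : R →* S) (Units.mkOfMulEqOne c c' hc.symm) *
        ∏ x ∈ t, v x.1 := by
      ext
      simp [ha, hv]
    exact hg ▸ mul_mem (SetLike.le_def.1 le_sup_left ⟨_, rfl⟩) (prod_mem fun x _ => hvH x.1)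
  refine eq_top_iff.2 fun f _ => ?_
  obtain ⟨m, a, ha⟩ := IsLocalization.Away.surj (∏ k, F k) (f : S)
  have hfa : f * (∏ k, v k) ^ m ∈ H := h_algebraMap _ a (by simp [← ha, hv])
  exact (H.mul_mem_cancel_right (pow_mem (prod_mem fun k _ => hvH k) m)).1 hfa

end LocalizationUnits

section Irreducibility

variable {σ R : Type*} [CommRing R] [IsDomain R]

theorem irreducible_one_add_X (i : σ) : Irreducible (1 + X i : MvPolynomial σ R) := by
  simpa [add_comm] using irreducible_mul_X_add (1 : MvPolynomial σ R) 1 i one_ne_zero (by simp)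
    (by simp) isRelPrime_one_left

theorem irreducible_one_add_X_add_X_mul_X {i j : σ} (hij : i ≠ j) :
    Irreducible (1 + X i + X i * X j : MvPolynomial σ R) := by
  classical
  have hvars : j ∉ (1 + X i : MvPolynomial σ R).vars := fun h => by
    simpa [hij.symm] using vars_add_subset _ _ h
  have hrel : IsRelPrime (X i : MvPolynomial σ R) (1 + X i) := fun _ hX h =>
    isUnit_of_dvd_one ((dvd_add_left hX).1 h)
  simpa [add_comm] using irreducible_mul_X_add _ _ j (X_ne_zero i) (by simpa using hij.symm)
    hvars hrel

end Irreducibility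

section Tropicalization

open Asymptotics Filter Topology
open scoped ComplexOrder

variable {n : ℕ}

/-- The nonzero polynomials with nonnegative coefficients, the class on which `tropPoly` is
additive and records the growth along one-parameter curves. Nonnegativity is that of the partial
order of `ℂ`, so it includes that the coefficients are real. -/
structure IsPositivePoly (F : PellPoly n) : Prop where
  ne_zero : F ≠ 0
  coeff_nonneg : ∀ m, 0 ≤ coeff m F

namespace IsPositivePoly

variable {F G : PellPoly n}

theorem monomial (m : Fin (n + 1) →₀ ℕ) {c : ℂ} (hc : 0 < c) :
    IsPositivePoly (MvPolynomial.monomial m c) where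
  ne_zero := by simpa using hc.ne'
  coeff_nonneg k := by
    rw [coeff_monomial]
    split_ifs
    exacts [hc.le, le_rfl]

theorem monomial_one (m : Fin (n + 1) →₀ ℕ) :
    IsPositivePoly (MvPolynomial.monomial m 1 : PellPoly n) :=
  .monomial m one_pos

theorem support_add (hF : IsPositivePoly F) (hG : IsPositivePoly G) :
    (F + G).support = F.support ∪ G.support := by
  ext m
  simp only [Finset.mem_union, mem_support_iff, coeff_add, ne_eq,
    add_eq_zero_iff_of_nonneg (hF.coeff_nonneg m) (hG.coeff_nonneg m), not_and_or]

theorem support_nonempty (hF : IsPositivePoly F) : F.support.Nonempty :=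
  MvPolynomial.support_nonempty.2 hF.ne_zero

theorem add (hF : IsPositivePoly F) (hG : IsPositivePoly G) : IsPositivePoly (F + G) where
  ne_zero := by
    rw [← MvPolynomial.support_nonempty, hF.support_add hG]
    exact hF.support_nonempty.inl
  coeff_nonneg m := by
    rw [coeff_add]
    exact add_nonneg (hF.coeff_nonneg m) (hG.coeff_nonneg m)

end IsPositivePoly

theorem tropPoly_eq_inf' {F : PellPoly n} (hF : F.support.Nonempty) (Y : Fin (n + 1) → ℤ) :
    tropPoly F Y = F.support.inf' hF (Finsupp.weight Y) := by
  simp [tropPoly, Finset.inf'_eq_csInf_image, iInf, Finsupp.weight_eq_sum, Set.image_eq_range]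

theorem tropPoly_monomial (m : Fin (n + 1) →₀ ℕ) {c : ℂ} (hc : c ≠ 0) (Y : Fin (n + 1) → ℤ) :
    tropPoly (monomial m c) Y = Finsupp.weight Y m := by
  classical
  have hsupp : (monomial m c).support = {m} := by simp [support_monomial, hc]
  simp [tropPoly_eq_inf' (hsupp ▸ Finset.singleton_nonempty m), hsupp]

theorem tropPoly_add {F G : PellPoly n} (hF : IsPositivePoly F) (hG : IsPositivePoly G)
    (Y : Fin (n + 1) → ℤ) : tropPoly (F + G) Y = min (tropPoly F Y) (tropPoly G Y) := by
  simp only [tropPoly_eq_inf' (hF.add hG).support_nonempty, hF.support_add hG,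
    Finset.inf'_union hF.support_nonempty hG.support_nonempty,
    tropPoly_eq_inf' hF.support_nonempty, tropPoly_eq_inf' hG.support_nonempty]

theorem zpow_sum_eq_prod {K ι : Type*} [CommGroupWithZero K] {s : K} (hs : s ≠ 0) (f : ι → ℤ)
    (t : Finset ι) : s ^ ∑ i ∈ t, f i = ∏ i ∈ t, s ^ f i := by
  classical
  induction t using Finset.induction_on with
  | empty => simp
  | insert i t hi ih => rw [Finset.sum_insert hi, Finset.prod_insert hi, zpow_add₀ hs, ih]

theorem eval_monomial_zpow (V : Fin (n + 1) → ℤ) (m : Fin (n + 1) →₀ ℕ) (c : ℂ) {s : ℝ}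
    (hs : s ≠ 0) :
    eval (fun i => ((s ^ V i : ℝ) : ℂ)) (monomial m c) = c * (s ^ Finsupp.weight V m : ℝ) := by
  simp only [eval_monomial, Finsupp.prod_fintype _ _ fun _ => pow_zero _, Finsupp.weight_eq_sum,
    zpow_sum_eq_prod hs, nsmul_eq_mul, mul_comm, zpow_mul, zpow_natCast, Complex.ofReal_prod,
    Complex.ofReal_pow]

theorem isBigO_zpow_zpow {a b : ℤ} (hab : a ≤ b) :
    (fun s : ℝ => s ^ b) =O[𝓝[>] 0] fun s : ℝ => s ^ a := by
  refine .of_bound' ?_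
  filter_upwards [Ioc_mem_nhdsGT one_pos] with s hs
  rw [norm_zpow, norm_zpow, Real.norm_of_nonneg hs.1.le]
  exact zpow_le_zpow_right_of_le_one₀ hs.1 hs.2 hab

theorem isTheta_eval_zpow_tropPoly {F : PellPoly n} (hF : IsPositivePoly F)
    (V : Fin (n + 1) → ℤ) :
    (fun s : ℝ => eval (fun i => ((s ^ V i : ℝ) : ℂ)) F) =Θ[𝓝[>] 0]
      fun s : ℝ => s ^ tropPoly F V := by
  set term : (Fin (n + 1) →₀ ℕ) → ℝ → ℂ := fun m s => coeff m F * (s ^ Finsupp.weight V m : ℝ)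
  have heval : (fun s : ℝ => eval (fun i => ((s ^ V i : ℝ) : ℂ)) F) =ᶠ[𝓝[>] 0]
      fun s => ∑ m ∈ F.support, term m s := by
    filter_upwards [self_mem_nhdsWithin] with s hs
    conv_lhs => rw [F.as_sum, map_sum]
    exact Finset.sum_congr rfl fun m _ => eval_monomial_zpow V m _ (ne_of_gt hs)
  have hterm (m) (hm : m ∈ F.support) :
      term m =Θ[𝓝[>] 0] fun s : ℝ => s ^ Finsupp.weight V m :=
    .const_mul_left (mem_support_iff.1 hm) (.of_norm_eventuallyEq_norm (by simp))
  have htrop := tropPoly_eq_inf' hF.support_nonempty V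
  refine heval.trans_isTheta ⟨.fun_sum fun m hm => ?_, ?_⟩
  · refine (hterm m hm).isBigO.trans (isBigO_zpow_zpow ?_)
    exact htrop ▸ Finset.inf'_le _ hm
  · obtain ⟨m, hm, hmin⟩ := F.support.exists_mem_eq_inf' hF.support_nonempty (Finsupp.weight V)
    rw [htrop, hmin]
    refine (hterm m hm).symm.isBigO.trans (.of_bound' ?_)
    filter_upwards [self_mem_nhdsWithin] with s hs
    -- The terms are nonnegative, so no cancellation destroys the one of lowest order.
    have hnonneg (k) : 0 ≤ term k s :=
      mul_nonneg (hF.coeff_nonneg k) (Complex.zero_le_real.2 (zpow_pos hs _).le)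
    exact CStarAlgebra.norm_le_norm_of_nonneg_of_le (hnonneg m)
      (Finset.single_le_sum (f := fun k => term k s) (fun k _ => hnonneg k) hm)

end Tropicalization

section PellPolynomials

variable {n : ℕ}

theorem pellP_eq_add_monomial (i : Fin (n + 1)) :
    pellP n i = monomial 0 1 + monomial (Finsupp.single i 1) 1 := rfl

theorem pellQ_eq_add_monomial (j : Fin n) :
    pellQ n j = monomial 0 1 + monomial (Finsupp.single j.castSucc 1) 1 +
      monomial (Finsupp.single j.castSucc 1 + Finsupp.single j.succ 1) 1 := by
  rw [pellQ, ← mul_one (1 : ℂ), ← monomial_mul, mul_one]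
  rfl

theorem isPositivePoly_pellF : ∀ k, IsPositivePoly (pellF n k)
  | .inl _ => .monomial_one _
  | .inr (.inl _) => .add (.monomial_one _) (.monomial_one _)
  | .inr (.inr j) => by
    rw [pellF, pellQ_eq_add_monomial]
    exact .add (.add (.monomial_one _) (.monomial_one _)) (.monomial_one _)

theorem tropPoly_X (i : Fin (n + 1)) (Y : Fin (n + 1) → ℤ) : tropPoly (X i) Y = Y i := by
  rw [X, tropPoly_monomial _ one_ne_zero, Finsupp.weight_single, one_smul]

theorem tropPoly_pellP (i : Fin (n + 1)) (Y : Fin (n + 1) → ℤ) :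
    tropPoly (pellP n i) Y = min 0 (Y i) := by
  rw [pellP_eq_add_monomial, tropPoly_add (.monomial_one _) (.monomial_one _)]
  simp only [tropPoly_monomial _ one_ne_zero, map_zero, Finsupp.weight_single, one_smul]

theorem tropPoly_pellQ (j : Fin n) (Y : Fin (n + 1) → ℤ) :
    tropPoly (pellQ n j) Y = min (min 0 (Y j.castSucc)) (Y j.castSucc + Y j.succ) := by
  rw [pellQ_eq_add_monomial,
    tropPoly_add (.add (.monomial_one _) (.monomial_one _)) (.monomial_one _),
    tropPoly_add (.monomial_one _) (.monomial_one _)]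
  simp only [tropPoly_monomial _ one_ne_zero, map_zero, map_add, Finsupp.weight_single, one_smul]

theorem prime_pellF : ∀ k, Prime (pellF n k)
  | .inl _ => X_prime
  | .inr (.inl _) => (irreducible_one_add_X _).prime
  | .inr (.inr _) => (irreducible_one_add_X_add_X_mul_X Fin.castSucc_lt_succ.ne).prime

end PellPolynomials

section PellMatrix

variable {n : ℕ}

@[elab_as_elim]
theorem pellIndex_cases {motive : PellIndex n → Prop}
    (y_castSucc : ∀ i : Fin n, motive (.inl i.castSucc)) (y_last : motive (.inl (Fin.last n)))
    (p_zero : motive (.inr (.inl 0))) (p_succ : ∀ i : Fin n, motive (.inr (.inl i.succ)))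
    (q : ∀ i : Fin n, motive (.inr (.inr i))) : ∀ k, motive k
  | .inl i => Fin.lastCases y_last y_castSucc i
  | .inr (.inl i) => Fin.cases p_zero p_succ i
  | .inr (.inr i) => q i

variable (n) in
/-- The explicit inverse of `pellMatrix n`: its rows are the exponent vectors of
`y_i p_{i+1} / q_i`, `y_d / p_d`, `1 / p_1`, `p_i / q_i` and `q_i / (p_i p_{i+1})`. -/
def pellMatrixInv : Matrix (PellIndex n) (PellIndex n) ℤ :=
  Matrix.of <| Sum.elim
    (Fin.snoc (α := fun _ => PellIndex n → ℤ)
      (fun i => Pi.single (.inl i.castSucc) 1 + Pi.single (.inr (.inl i.succ)) 1 -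
        Pi.single (.inr (.inr i)) 1)
      (Pi.single (.inl (Fin.last n)) 1 - Pi.single (.inr (.inl (Fin.last n))) 1)) <|
    Sum.elim
      (Fin.cons (α := fun _ => PellIndex n → ℤ)
        (-Pi.single (.inr (.inl 0)) 1)
        (fun i => Pi.single (.inr (.inl i.castSucc)) 1 - Pi.single (.inr (.inr i)) 1))
      (fun i => Pi.single (.inr (.inr i)) 1 -
        (Pi.single (.inr (.inl i.castSucc)) 1 + Pi.single (.inr (.inl i.succ)) 1))

theorem pellMatrixInv_y_castSucc (i : Fin n) :
    pellMatrixInv n (.inl i.castSucc) = Pi.single (.inl i.castSucc) 1 +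
      Pi.single (.inr (.inl i.succ)) 1 - Pi.single (.inr (.inr i)) 1 := by
  ext
  simp [pellMatrixInv]

theorem pellMatrixInv_y_last :
    pellMatrixInv n (.inl (Fin.last n)) =
      Pi.single (.inl (Fin.last n)) 1 - Pi.single (.inr (.inl (Fin.last n))) 1 := by
  ext
  simp [pellMatrixInv]

theorem pellMatrixInv_p_zero :
    pellMatrixInv n (.inr (.inl 0)) = -Pi.single (.inr (.inl 0)) 1 := rfl

theorem pellMatrixInv_p_succ (i : Fin n) :
    pellMatrixInv n (.inr (.inl i.succ)) =
      Pi.single (.inr (.inl i.castSucc)) 1 - Pi.single (.inr (.inr i)) 1 := rfl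

theorem pellMatrixInv_q (i : Fin n) :
    pellMatrixInv n (.inr (.inr i)) = Pi.single (.inr (.inr i)) 1 -
      (Pi.single (.inr (.inl i.castSucc)) 1 + Pi.single (.inr (.inl i.succ)) 1) := rfl

theorem pellMatrix_y (i : Fin (n + 1)) (l : PellIndex n) :
    pellMatrix n (.inl i) l = pellRay n l i := tropPoly_X i _

theorem pellMatrix_p (i : Fin (n + 1)) (l : PellIndex n) :
    pellMatrix n (.inr (.inl i)) l = min 0 (pellRay n l i) := tropPoly_pellP i _

theorem pellMatrix_q (j : Fin n) (l : PellIndex n) :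
    pellMatrix n (.inr (.inr j)) l =
      min (min 0 (pellRay n l j.castSucc)) (pellRay n l j.castSucc + pellRay n l j.succ) :=
  tropPoly_pellQ j _

theorem pellMatrixInv_mul_pellMatrix : pellMatrixInv n * pellMatrix n = 1 := by
  -- Row `k` of the product is the piecewise linear function `trop(u_k)`, evaluated at the rays.
  ext k l
  rw [Matrix.mul_apply_eq_vecMul]
  induction k using pellIndex_cases <;> rcases l with j | j | j <;>
    simp only [pellMatrixInv_y_castSucc, pellMatrixInv_y_last, pellMatrixInv_p_zero,
      pellMatrixInv_p_succ, pellMatrixInv_q, Matrix.add_vecMul, Matrix.sub_vecMul,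
      Matrix.neg_vecMul, Matrix.single_one_vecMul, Matrix.row_apply, Pi.add_apply, Pi.sub_apply,
      Pi.neg_apply, pellMatrix_y, pellMatrix_p, pellMatrix_q, pellRay, Pi.single_apply,
      Matrix.one_apply, Fin.ext_iff] <;>
    grind

theorem isUnit_pellMatrix : IsUnit (pellMatrix n) :=
  .of_mul_eq_one_right _ pellMatrixInv_mul_pellMatrix

theorem inv_pellMatrix : (pellMatrix n)⁻¹ = pellMatrixInv n :=
  Matrix.inv_eq_left_inv pellMatrixInv_mul_pellMatrix

end PellMatrix

section LaurentMonomials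

variable {n : ℕ}

variable (n) in
/-- The homomorphism `α ↦ z^α` from the lattice of exponents to the group of units, the latter
written additively so that it is a linear map of `ℤ`-modules. -/
noncomputable def laurentLinearMap : (PellIndex n → ℤ) →ₗ[ℤ] Additive (PellRing n)ˣ :=
  Fintype.linearCombination ℤ fun k => Additive.ofMul (pellUnit n k)

theorem laurentLinearMap_apply (α : PellIndex n → ℤ) :
    laurentLinearMap n α = Additive.ofMul (laurentMonomial n α) := rfl

theorem laurentLinearMap_single (k : PellIndex n) :
    laurentLinearMap n (Pi.single k 1) = Additive.ofMul (pellUnit n k) := by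
  rw [laurentLinearMap, Fintype.linearCombination_apply_single, one_smul]

theorem ofMul_pellU (k : PellIndex n) :
    Additive.ofMul (pellU n k) = laurentLinearMap n (pellMatrixInv n k) := by
  rw [laurentLinearMap_apply, pellU, inv_pellMatrix]

theorem pellU_y_castSucc (i : Fin n) :
    pellU n (.inl i.castSucc) = yUnit n i.castSucc * pUnit n i.succ / qUnit n i := by
  apply Additive.ofMul.injective
  simp only [ofMul_pellU, pellMatrixInv_y_castSucc, map_add, map_sub, laurentLinearMap_single]
  rfl

theorem pellU_y_last :
    pellU n (.inl (Fin.last n)) = yUnit n (Fin.last n) / pUnit n (Fin.last n) := by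
  apply Additive.ofMul.injective
  simp only [ofMul_pellU, pellMatrixInv_y_last, map_sub, laurentLinearMap_single]
  rfl

theorem pellU_p_zero : pellU n (.inr (.inl 0)) = 1 / pUnit n 0 := by
  apply Additive.ofMul.injective
  simp only [ofMul_pellU, pellMatrixInv_p_zero, map_neg, laurentLinearMap_single, one_div]
  rfl

theorem pellU_p_succ (i : Fin n) :
    pellU n (.inr (.inl i.succ)) = pUnit n i.castSucc / qUnit n i := by
  apply Additive.ofMul.injective
  simp only [ofMul_pellU, pellMatrixInv_p_succ, map_sub, laurentLinearMap_single]
  rfl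

theorem pellU_q (i : Fin n) :
    pellU n (.inr (.inr i)) = qUnit n i / (pUnit n i.castSucc * pUnit n i.succ) := by
  apply Additive.ofMul.injective
  simp only [ofMul_pellU, pellMatrixInv_q, map_add, map_sub, laurentLinearMap_single]
  rfl

theorem laurentMonomial_eq_prod_pellU (α : PellIndex n → ℤ) :
    laurentMonomial n α = ∏ k, pellU n k ^ Matrix.vecMul α (pellMatrix n) k := by
  have hα : α = ∑ k, Matrix.vecMul α (pellMatrix n) k • pellMatrixInv n k := by
    rw [← Matrix.vecMul_eq_sum, Matrix.vecMul_vecMul,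
      mul_eq_one_comm.1 pellMatrixInv_mul_pellMatrix, Matrix.vecMul_one]
  apply Additive.ofMul.injective
  rw [← laurentLinearMap_apply]
  conv_lhs => rw [hα]
  simp only [map_sum, map_smul, ← ofMul_pellU]
  rfl

end LaurentMonomials

section Boundedness

open Asymptotics Filter Topology

variable {n : ℕ}

/-- The absolute value of an invertible regular function at a point of the positive orthant, as a
homomorphism. -/
noncomputable def absEval (y : Fin (n + 1) → ℝ) (hy : ∀ i, 0 < y i) : (PellRing n)ˣ →* ℝ :=
  ((normHom : ℂ →*₀ ℝ) : ℂ →* ℝ).comp <|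
    (pellEval ⟨_, ofReal_mem_openPellspace y hy⟩ : PellRing n →* ℂ).comp (Units.coeHom _)

theorem isBoundedOnPositive_iff {f : (PellRing n)ˣ} :
    IsBoundedOnPositive (f : PellRing n) ↔ ∃ C, ∀ y hy, absEval y hy f ≤ C := Iff.rfl

theorem pellEval_algebraMap (x : openPellspace n) (F : PellPoly n) :
    pellEval x (algebraMap (PellPoly n) (PellRing n) F) = eval (x : Fin (n + 1) → ℂ) F :=
  IsLocalization.Away.lift_eq _ _ _

section absEval

variable (y : Fin (n + 1) → ℝ) (hy : ∀ i, 0 < y i)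

theorem absEval_pellUnit (k : PellIndex n) :
    absEval y hy (pellUnit n k) = ‖eval (fun i => (y i : ℂ)) (pellF n k)‖ :=
  congrArg norm (pellEval_algebraMap _ _)

theorem absEval_constUnit (c : ℂˣ) : absEval y hy (constUnit n c) = ‖(c : ℂ)‖ := by
  have h := pellEval_algebraMap ⟨_, ofReal_mem_openPellspace y hy⟩ (C (c : ℂ))
  rw [eval_C] at h
  exact congrArg norm h

theorem absEval_yUnit (i : Fin (n + 1)) : absEval y hy (yUnit n i) = y i := by
  simp [yUnit, absEval_pellUnit, pellF, (hy i).le]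

theorem absEval_pUnit (i : Fin (n + 1)) : absEval y hy (pUnit n i) = 1 + y i := by
  have := hy i
  rw [pUnit, absEval_pellUnit, ← Real.norm_of_nonneg (by positivity : 0 ≤ 1 + y i),
    ← Complex.norm_real]
  simp [pellF, pellP]

theorem absEval_qUnit (j : Fin n) :
    absEval y hy (qUnit n j) = 1 + y j.castSucc + y j.castSucc * y j.succ := by
  have h₁ := hy j.castSucc
  have h₂ := hy j.succ
  rw [qUnit, absEval_pellUnit, ← Real.norm_of_nonneg
    (by positivity : 0 ≤ 1 + y j.castSucc + y j.castSucc * y j.succ), ← Complex.norm_real]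
  simp [pellF, pellQ]

theorem absEval_laurentMonomial (α : PellIndex n → ℤ) :
    absEval y hy (laurentMonomial n α) = ∏ k, ‖eval (fun i => (y i : ℂ)) (pellF n k)‖ ^ α k := by
  simp [laurentMonomial, map_prod, map_zpow, absEval_pellUnit]

theorem absEval_pellU_le_one (k : PellIndex n) : absEval y hy (pellU n k) ≤ 1 := by
  have pos (i : Fin (n + 1)) : 0 < 1 + y i := by linarith [hy i]
  have pos' (i : Fin n) : 0 < 1 + y i.castSucc + y i.castSucc * y i.succ := by
    linarith [hy i.castSucc, mul_pos (hy i.castSucc) (hy i.succ)]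
  induction k using pellIndex_cases with
  | y_castSucc i =>
    rw [pellU_y_castSucc, map_div, map_mul, absEval_yUnit, absEval_pUnit, absEval_qUnit,
      div_le_one (pos' i)]
    linarith
  | y_last =>
    rw [pellU_y_last, map_div, absEval_yUnit, absEval_pUnit, div_le_one (pos _)]
    linarith
  | p_zero =>
    rw [pellU_p_zero, map_div, map_one, absEval_pUnit, div_le_one (pos _)]
    linarith [hy 0]
  | p_succ i =>
    rw [pellU_p_succ, map_div, absEval_pUnit, absEval_qUnit, div_le_one (pos' i)]
    linarith [mul_pos (hy i.castSucc) (hy i.succ)]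
  | q i =>
    rw [pellU_q, map_div, map_mul, absEval_pUnit, absEval_pUnit, absEval_qUnit,
      div_le_one (mul_pos (pos _) (pos _))]
    linarith [hy i.succ]

end absEval

theorem pellU_mem_boundedChars (k : PellIndex n) : pellU n k ∈ boundedChars n :=
  ⟨⟨_, rfl⟩, isBoundedOnPositive_iff.2 ⟨1, fun y hy => absEval_pellU_le_one y hy k⟩⟩

theorem nonneg_of_isBigO_zpow_one {e : ℤ}
    (h : (fun s : ℝ => s ^ e) =O[𝓝[>] 0] fun _ => (1 : ℝ)) : 0 ≤ e := by
  by_contra! he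
  have hinv : (fun s : ℝ => s⁻¹) =O[𝓝[>] 0] fun _ => (1 : ℝ) := by
    simpa using (isBigO_zpow_zpow (by lia : e ≤ -1)).trans h
  exact not_isBoundedUnder_of_tendsto_atTop
    (tendsto_norm_atTop_atTop.comp tendsto_inv_nhdsGT_zero) hinv.isBoundedUnder_le

theorem isTheta_prod_norm_eval_pellF (α : PellIndex n → ℤ) (V : Fin (n + 1) → ℤ) :
    (fun s : ℝ => ∏ k, ‖eval (fun i => ((s ^ V i : ℝ) : ℂ)) (pellF n k)‖ ^ α k) =Θ[𝓝[>] 0]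
      fun s => s ^ ∑ k, α k * tropPoly (pellF n k) V := by
  have hfactor (k : PellIndex n) :
      (fun s : ℝ => ‖eval (fun i => ((s ^ V i : ℝ) : ℂ)) (pellF n k)‖ ^ α k) =Θ[𝓝[>] 0]
        fun s => s ^ (α k * tropPoly (pellF n k) V) := by
    simpa only [mul_comm (α k), zpow_mul] using
      (isTheta_eval_zpow_tropPoly (isPositivePoly_pellF k) V).norm_left.zpow (α k)
  refine (IsTheta.finsetProd fun k _ => hfactor k).trans_eventuallyEq ?_
  filter_upwards [self_mem_nhdsWithin] with s hs
  exact (zpow_sum_eq_prod (ne_of_gt hs) _ _).symm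

theorem vecMul_pellMatrix_nonneg {α : PellIndex n → ℤ}
    (hα : IsBoundedOnPositive (laurentMonomial n α : PellRing n)) :
    0 ≤ Matrix.vecMul α (pellMatrix n) := by
  intro j
  obtain ⟨C, hC⟩ := isBoundedOnPositive_iff.1 hα
  have htheta := isTheta_prod_norm_eval_pellF α (pellRay n j)
  refine nonneg_of_isBigO_zpow_one (htheta.symm.isBigO.trans (.of_bound C ?_))
  filter_upwards [self_mem_nhdsWithin] with s hs
  have hbound := hC (fun i => s ^ pellRay n j i) fun i => zpow_pos hs _
  rw [absEval_laurentMonomial] at hbound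
  simpa [Real.norm_of_nonneg, Finset.prod_nonneg] using hbound

theorem boundedChars_eq_closure_range_pellU :
    boundedChars n = Submonoid.closure (Set.range (pellU n)) := by
  apply le_antisymm
  · rintro _ ⟨⟨α, rfl⟩, hα⟩
    rw [laurentMonomial_eq_prod_pellU]
    refine prod_mem fun k _ => ?_
    lift Matrix.vecMul α (pellMatrix n) k to ℕ using vecMul_pellMatrix_nonneg hα k with e
    rw [zpow_natCast]
    exact pow_mem (Submonoid.subset_closure (Set.mem_range_self k)) e
  · rw [Submonoid.closure_le]
    rintro _ ⟨k, rfl⟩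
    exact pellU_mem_boundedChars k

end Boundedness

section CharacterLattice

variable {n : ℕ}

theorem eq_zero_of_laurentMonomial_eq_constUnit {α : PellIndex n → ℤ} {c : ℂˣ}
    (h : laurentMonomial n α = constUnit n c) : α = 0 := by
  have hconst (d : ℂˣ) : IsBoundedOnPositive (constUnit n d : PellRing n) :=
    isBoundedOnPositive_iff.2 ⟨_, fun y hy => (absEval_constUnit y hy d).le⟩
  have hneg : laurentMonomial n (-α) = constUnit n c⁻¹ := by
    rw [map_inv, ← h]
    exact Additive.ofMul.injective (map_neg (laurentLinearMap n) α)
  have hle := vecMul_pellMatrix_nonneg (hneg ▸ hconst c⁻¹)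
  rw [Matrix.neg_vecMul, neg_nonneg] at hle
  have hzero := hle.antisymm (vecMul_pellMatrix_nonneg (h ▸ hconst c))
  exact Matrix.vecMul_injective_of_isUnit isUnit_pellMatrix
    (hzero.trans (Matrix.zero_vecMul _).symm)

theorem laurentLinearMap_ker : LinearMap.ker (laurentLinearMap n) = ⊥ :=
  LinearMap.ker_eq_bot'.2 fun _ hα => eq_zero_of_laurentMonomial_eq_constUnit (c := 1) <|
    (Additive.ofMul.injective hα).trans (map_one (constUnit n)).symm

theorem linearIndependent_pellU : LinearIndependent ℤ fun k => Additive.ofMul (pellU n k) := by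
  simp only [ofMul_pellU]
  exact (Matrix.linearIndependent_rows_of_isUnit
    (.of_mul_eq_one _ pellMatrixInv_mul_pellMatrix)).map' _ laurentLinearMap_ker

theorem linearIndependent_nat_pellU : LinearIndependent ℕ fun k => Additive.ofMul (pellU n k) :=
  linearIndependent_pellU.restrict_scalars' ℕ

theorem charLattice_eq_closure_range_pellUnit :
    charLattice n = Subgroup.closure (Set.range (pellUnit n)) := by
  apply le_antisymm
  · rintro _ ⟨α, rfl⟩
    exact prod_mem fun k _ => zpow_mem (Subgroup.subset_closure (Set.mem_range_self k)) _
  · rw [Subgroup.closure_le]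
    rintro _ ⟨k, rfl⟩
    exact ⟨Pi.single k 1, Additive.ofMul.injective (laurentLinearMap_single k)⟩

theorem unitsMap_algebraMap_surjective {σ R : Type*} [CommRing R] [IsReduced R] :
    Function.Surjective (Units.map (algebraMap R (MvPolynomial σ R) : R →* MvPolynomial σ R)) := by
  intro P
  obtain ⟨c, hc, hP⟩ := isUnit_iff_eq_C_of_isReduced.1 P.isUnit
  exact ⟨hc.unit, Units.ext hP.symm⟩

theorem range_constUnit :
    (constUnit n).range =
      (Units.map (algebraMap (PellPoly n) (PellRing n) : PellPoly n →* PellRing n)).range := by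
  have hcomp : constUnit n =
      (Units.map (algebraMap (PellPoly n) (PellRing n) : PellPoly n →* PellRing n)).comp
        (Units.map (algebraMap ℂ (PellPoly n) : ℂ →* PellPoly n)) := by
    ext c
    exact IsScalarTower.algebraMap_apply ℂ (PellPoly n) (PellRing n) c
  rw [hcomp, MonoidHom.range_comp, MonoidHom.range_eq_top.2 unitsMap_algebraMap_surjective,
    MonoidHom.range_eq_map]

theorem range_constUnit_sup_charLattice : (constUnit n).range ⊔ charLattice n = ⊤ := by
  have : IsLocalization.Away (∏ k, pellF n k) (PellRing n) :=
    inferInstanceAs (IsLocalization.Away (pellProd n) (PellRing n))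
  rw [range_constUnit, charLattice_eq_closure_range_pellUnit]
  exact range_unitsMap_sup_closure_eq_top prime_pellF fun _ => rfl

theorem disjoint_range_constUnit_charLattice : Disjoint (constUnit n).range (charLattice n) := by
  rw [Subgroup.disjoint_def]
  rintro _ ⟨c, rfl⟩ ⟨α, hα⟩
  rw [← hα, eq_zero_of_laurentMonomial_eq_constUnit hα]
  exact Additive.ofMul.injective (map_zero (laurentLinearMap n))

theorem constUnit_injective : Function.Injective (constUnit n) := by
  have : Nontrivial (PellRing n) :=
    (pellEval ⟨_, ofReal_mem_openPellspace 1 fun _ => one_pos⟩).domain_nontrivial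
  exact Units.map_injective (algebraMap ℂ (PellRing n)).injective

theorem existsUnique_constUnit_mul (f : (PellRing n)ˣ) :
    ∃! c : ℂˣ × charLattice n, f = constUnit n c.1 * c.2 := by
  have hf : f ∈ (constUnit n).range ⊔ charLattice n :=
    range_constUnit_sup_charLattice ▸ Subgroup.mem_top f
  obtain ⟨_, ⟨c, rfl⟩, z, hz, rfl⟩ := Subgroup.mem_sup.1 hf
  refine ⟨(c, ⟨z, hz⟩), rfl, ?_⟩
  rintro ⟨d, w⟩ h
  have hpair := Subgroup.mul_injective_of_disjoint disjoint_range_constUnit_charLattice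
    (a₁ := (⟨constUnit n c, c, rfl⟩, ⟨z, hz⟩)) (a₂ := (⟨constUnit n d, d, rfl⟩, w)) h
  obtain ⟨hcd, rfl⟩ := Prod.ext_iff.1 hpair
  rw [constUnit_injective (congrArg Subtype.val hcd)]

theorem exists_basis_pellU :
    ∃ b : Module.Basis (PellIndex n) ℤ (Additive (charLattice n)),
      ∀ i, ((b i).toMul : (PellRing n)ˣ) = pellU n i := by
  set u : PellIndex n → Additive (charLattice n) := fun k => .ofMul ⟨pellU n k, _, rfl⟩
  have hu : LinearIndependent ℤ u :=
    .of_comp (charLattice n).subtype.toAdditive.toIntLinearMap linearIndependent_pellU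
  have hspan : ⊤ ≤ Submodule.span ℤ (Set.range u) := by
    intro f _
    obtain ⟨α, hα⟩ := f.toMul.2
    have hf : f = ∑ k, Matrix.vecMul α (pellMatrix n) k • u k := by
      apply Additive.toMul.injective
      apply Subtype.ext
      simp [u, ← hα, laurentMonomial_eq_prod_pellU]
    rw [hf]
    exact Submodule.sum_smul_mem _ _ fun k _ => Submodule.subset_span (Set.mem_range_self k)
  exact ⟨.mk hu hspan, fun k => by rw [Module.Basis.mk_apply]; rfl⟩

end CharacterLattice

theorem mainTheorem5 (n : ℕ) :
    -- `M_d` is invertible over `ℤ`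
    IsUnit (pellMatrix n) ∧
    -- explicit form of the `u_i`
    (∀ i : Fin n, pellU n (.inl i.castSucc)
      = yUnit n i.castSucc * pUnit n i.succ / qUnit n i) ∧
    pellU n (.inl (Fin.last n)) = yUnit n (Fin.last n) / pUnit n (Fin.last n) ∧
    pellU n (.inr (.inl 0)) = 1 / pUnit n 0 ∧
    (∀ i : Fin n, pellU n (.inr (.inl i.succ)) = pUnit n i.castSucc / qUnit n i) ∧
    (∀ i : Fin n, pellU n (.inr (.inr i))
      = qUnit n i / (pUnit n i.castSucc * pUnit n i.succ)) ∧
    -- the `u_i` are the minimal generators of `Γ`: they are its indecomposable elements, and they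
    -- form the least generating set
    Set.range (pellU n) = indecomposables (boundedChars n) ∧
    IsLeast {S : Set (PellRing n)ˣ | Submonoid.closure S = boundedChars n}
      (Set.range (pellU n)) ∧
    -- `Λ` is the character lattice of `𝒰_d`: each invertible regular function is, uniquely, a
    -- nonzero constant times an element of `Λ`
    (∀ f : (PellRing n)ˣ, ∃! c : ℂˣ × charLattice n, f = constUnit n c.1 * c.2) ∧
    -- the `u_i` form a `ℤ`-basis of `Λ`
    ∃ b : Module.Basis (PellIndex n) ℤ (Additive (charLattice n)),
      ∀ i, ((b i).toMul : (PellRing n)ˣ) = pellU n i :=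
  ⟨isUnit_pellMatrix, pellU_y_castSucc, pellU_y_last, pellU_p_zero, pellU_p_succ, pellU_q,
    boundedChars_eq_closure_range_pellU ▸
      range_eq_indecomposables_closure linearIndependent_nat_pellU,
    boundedChars_eq_closure_range_pellU ▸ isLeast_range_closure_eq linearIndependent_nat_pellU,
    existsUnique_constUnit_mul, exists_basis_pellU⟩
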